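/- Matroids are finite. For a matroid $M$ with ground set $E(M)$ and rank function $r$, and for $S,T\subseteq E(M)$, write $\sqcap(S,T)=r(S)+r(T)-r(S\cup T)$. An \emph{exact $3$-separation} of $M$ is a partition $(A,B)$ of $E(M)$ with $|A|,|B|\ge 3$ and $r(A)+r(B)-r(M)=2$. Given such a pair, an \emph{$A$-strand} is a minimal subset $A'$ of $A$ with $\sqcap(A',B)=1$, and a \emph{$B$-strand} is a minimal subset $B'$ of $B$ with $\sqcap(A,B')=1$. An \emph{extension} of $M$ by a set $T$ of new elements is a matroid $N$ with ground set $E(M)\cup T$, where $T\cap E(M)=\emptyset$, such that $N\backslash T=M$. \textbf{Theorem 1.2.} Let $(X,Y,Z)$ be a partition of the ground set of a matroid $M$, where $Y$ may be empty, and let $(X,Y\cup Z)$ and $(X\cup Y,Z)$ be exact $3$-separations of $M$. Let $p\neq q$ be elements not in $E(M)$. Assume that there are an $X$-strand $X_0$ and a $(Y\cup Z)$-strand $Y_0$ of $M$ (with respect to the $3$-separation $(X,Y\cup Z)$) such that $\sqcap(X_0,Y_0)=1$ and $M$ has an extension by $p$ in which $X_0\cup\{p\}$ and $Y_0\cup\{p\}$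 are circuits. Assume also that there are an $(X\cup Y)$-strand $Y_1$ and a $Z$-strand $Z_1$ of $M$ (with respect to the $3$-separation $(X\cup Y,Z)$) such that $\sqcap(Y_1,Z_1)=1$ and $M$ has an extension by $q$ in which $Y_1\cup\{q\}$ and $Z_1\cup\{q\}$ are circuits. Then there is exactly one extension of $M$ by $\{p,q\}$ in which all four of the sets $X_0\cup\{p\}$, $Y_0\cup\{p\}$, $Y_1\cup\{q\}$ and $Z_1\cup\{q\}$ are circuits. -/

import Mathlib

open Set

namespace Matroid

/-- The rank `r_M(S)` of a set `S` in a (finite) matroid, as an integer. -/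
noncomputable def intRk {α : Type*} (M : Matroid α) (S : Set α) : ℤ :=
  ((M.eRk S).toNat : ℤ)

/-- The local connectivity `⊓(S, T) = r(S) + r(T) - r(S ∪ T)` in a (finite) matroid. -/
noncomputable def localConnectivity {α : Type*} (M : Matroid α) (S T : Set α) : ℤ :=
  M.intRk S + M.intRk T - M.intRk (S ∪ T)

/-- `(A, B)` is an exact `3`-separation of the (finite) matroid `M`: a partition of the ground set
into two sets with at least three elements each such that `r(A) + r(B) - r(M) = 2`. -/
structure IsExactThreeSeparation {α : Type*} (M : Matroid α) (A B : Set α) : Prop where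
  union_eq : A ∪ B = M.E
  disjoint : Disjoint A B
  three_le_left : 3 ≤ A.encard
  three_le_right : 3 ≤ B.encard
  rank_eq : M.intRk A + M.intRk B - M.intRk M.E = 2

/-- For an exact `3`-separation `(A, B)` of `M`, the set `S` is an `A`-strand: a minimal subset
of `A` whose local connectivity with `B` is one. The `B`-strands are the sets satisfying
`M.IsStrand B A`. -/
def IsStrand {α : Type*} (M : Matroid α) (A B S : Set α) : Prop :=
  Minimal (fun S' : Set α => S' ⊆ A ∧ M.localConnectivity S' B = 1) S

/-- `N` is an extension of `M` by the set `T` of new elements: `T ⊆ E(N)` and `N` with `T` deleted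
is `M`. In particular `T` is disjoint from `E(M)`, and `E(N) = E(M) ∪ T`. -/
def IsExtensionBy {α : Type*} (M N : Matroid α) (T : Set α) : Prop :=
  T ⊆ N.E ∧ N ＼ T = M

end Matroid

/-! Let `A`, `B` be the sides of a 3-separation with strands `S ⊆ A`, `T ⊆ B`. A point `e` spanned
by both strands lies in the guts, and for `F ⊆ A`, `G ⊆ B` whether `F ∪ G` spans `e` can be read off
without `e`: either `F` is not skew to `T`, or `G` is not skew to `S`, or `F ∪ B` and `A ∪ G` form a
modular pair over `F ∪ G`. This is `IsGutsPair.mem_closure_union_iff`. The spanning sets determine a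
one-element extension, so each of `p`, `q` can be added in at most one way.

Conversely, this family of spanning sets is a modular cut as soon as non-skewness behaves like
"meets the guts in the same point" (`GutsCompatible`). That condition is necessary for `e` to exist
(`IsGutsPair.gutsCompatible`) and sufficient to construct it (`IsGutsPair.exists_isExtensionBy`).

Let `P` be the extension by `p`. The extension of `M` by `q` shows that `M` is compatible at the
second separation. Compatibility passes to `P`, with `p` placed on the `X ∪ Y` side, because `p` can
always be traded for old elements there (`exists_forall_localConnectivity_insert_eq`). Hence `q` can
be added to `P`, and in one way only. -/

namespace Matroid

variable {α : Type*} {M N : Matroid α} {A B S T F G I J U : Set α} {e f : α}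

/-! ### Integer-valued rank -/

section Rank

lemma coe_toNat_eRk (M : Matroid α) [M.RankFinite] (S : Set α) :
    ((M.eRk S).toNat : ℕ∞) = M.eRk S :=
  ENat.natCast_toNat (eRk_ne_top_iff.2 (M.isRkFinite_set S))

lemma intRk_le_intRk_iff [M.RankFinite] : M.intRk S ≤ M.intRk T ↔ M.eRk S ≤ M.eRk T := by
  rw [intRk, intRk, ← M.coe_toNat_eRk S, ← M.coe_toNat_eRk T]
  simp

lemma intRk_mono (M : Matroid α) [M.RankFinite] (h : S ⊆ T) : M.intRk S ≤ M.intRk T :=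
  intRk_le_intRk_iff.2 (M.eRk_mono h)

@[simp] lemma intRk_empty (M : Matroid α) : M.intRk ∅ = 0 := by simp [intRk]

lemma intRk_submod (M : Matroid α) [M.RankFinite] (hI : I ⊆ S ∩ T) (hU : U ⊆ S ∪ T) :
    M.intRk I + M.intRk U ≤ M.intRk S + M.intRk T := by
  have h := M.eRk_inter_add_eRk_union_le S T
  rw [← M.coe_toNat_eRk S, ← M.coe_toNat_eRk T, ← M.coe_toNat_eRk (S ∩ T),
    ← M.coe_toNat_eRk (S ∪ T)] at h
  have h' : M.intRk (S ∩ T) + M.intRk (S ∪ T) ≤ M.intRk S + M.intRk T := by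
    unfold intRk
    exact_mod_cast h
  linarith [M.intRk_mono hI, M.intRk_mono hU]

lemma intRk_insert_le (M : Matroid α) [M.RankFinite] (e : α) (S : Set α) :
    M.intRk (insert e S) ≤ M.intRk S + 1 := by
  have h := M.eRk_insert_le_add_one e S
  rw [← M.coe_toNat_eRk S, ← M.coe_toNat_eRk (insert e S)] at h
  unfold intRk
  exact_mod_cast h

lemma le_intRk_insert (M : Matroid α) [M.RankFinite] (e : α) (S : Set α) :
    M.intRk S ≤ M.intRk (insert e S) :=
  M.intRk_mono (subset_insert e S)

lemma intRk_insert_of_mem_closure (h : e ∈ M.closure S) : M.intRk (insert e S) = M.intRk S := by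
  unfold intRk
  rw [← M.eRk_closure_eq (insert e S), closure_insert_eq_of_mem_closure h, eRk_closure_eq]

lemma mem_closure_of_intRk_insert_le [M.RankFinite] (he : e ∈ M.E)
    (h : M.intRk (insert e S) ≤ M.intRk S) : e ∈ M.closure S := by
  by_contra hcl
  have h' := M.eRk_insert_eq_add_one ⟨he, hcl⟩
  rw [← M.coe_toNat_eRk S, ← M.coe_toNat_eRk (insert e S)] at h'
  unfold intRk at h
  norm_cast at h' h
  omega

lemma intRk_insert_of_notMem_closure [M.RankFinite] (he : e ∈ M.E) (h : e ∉ M.closure S) :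
    M.intRk (insert e S) = M.intRk S + 1 := by
  have h1 := M.intRk_insert_le e S
  have h2 : ¬ M.intRk (insert e S) ≤ M.intRk S := fun h' ↦ h (mem_closure_of_intRk_insert_le he h')
  omega

lemma intRk_closure (M : Matroid α) (S : Set α) : M.intRk (M.closure S) = M.intRk S := by
  simp [intRk]

lemma Indep.intRk_eq_ncard (h : M.Indep I) : M.intRk I = I.ncard := by
  rw [intRk, h.eRk_eq_encard, ncard_def]

lemma IsNonloop.intRk_eq (h : M.IsNonloop e) : M.intRk {e} = 1 := by
  simp [intRk, h.eRk_eq]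

end Rank

/-! ### Monotonicity of local connectivity -/

section LocalConnectivity

lemma localConnectivity_comm (M : Matroid α) (S T : Set α) :
    M.localConnectivity S T = M.localConnectivity T S := by
  unfold localConnectivity
  rw [union_comm, add_comm]

lemma localConnectivity_nonneg (M : Matroid α) [M.RankFinite] (S T : Set α) :
    0 ≤ M.localConnectivity S T := by
  have := M.intRk_submod (empty_subset (S ∩ T)) Subset.rfl
  rw [intRk_empty] at this
  unfold localConnectivity
  linarith

lemma localConnectivity_mono_left (M : Matroid α) [M.RankFinite] (h : F ⊆ S) (T : Set α) :
    M.localConnectivity F T ≤ M.localConnectivity S T := by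
  have := M.intRk_submod (S := S) (T := F ∪ T) (I := F) (U := S ∪ T) (by grind) (by grind)
  unfold localConnectivity
  linarith

lemma localConnectivity_mono_right (M : Matroid α) [M.RankFinite] (S : Set α) (h : G ⊆ T) :
    M.localConnectivity S G ≤ M.localConnectivity S T := by
  rw [localConnectivity_comm M S, localConnectivity_comm M S]
  exact M.localConnectivity_mono_left h S

lemma localConnectivity_mono (M : Matroid α) [M.RankFinite] (hS : F ⊆ S) (hT : G ⊆ T) :
    M.localConnectivity F G ≤ M.localConnectivity S T :=
  (M.localConnectivity_mono_left hS G).trans (M.localConnectivity_mono_right S hT)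

/-- If `F ⊆ A` and `A` have the same connectivity to `B`, then they have the same
connectivity to every subset of `B`. -/
lemma localConnectivity_eq_of_subset [M.RankFinite] (hF : F ⊆ A) (hT : T ⊆ B)
    (h : M.localConnectivity A B ≤ M.localConnectivity F B) :
    M.localConnectivity F T = M.localConnectivity A T := by
  refine (M.localConnectivity_mono_left hF T).antisymm ?_
  have := M.intRk_submod (S := A ∪ T) (T := F ∪ B) (I := F ∪ T) (U := A ∪ B) (by grind) (by grind)
  unfold localConnectivity at *
  linarith

end LocalConnectivity

/-! ### Single-element extensions and modular cuts -/

section Extension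

lemma IsExtensionBy.ground_eq (h : M.IsExtensionBy N T) : N.E = M.E ∪ T := by
  rw [← h.2, delete_ground, sdiff_union_of_subset h.1]

lemma IsExtensionBy.disjoint (h : M.IsExtensionBy N T) : Disjoint M.E T := by
  rw [← h.2, delete_ground]
  exact disjoint_sdiff_left

lemma IsExtensionBy.notMem_ground (h : M.IsExtensionBy N {e}) : e ∉ M.E :=
  disjoint_singleton_right.1 h.disjoint

lemma IsExtensionBy.mem_ground (h : M.IsExtensionBy N {e}) : e ∈ N.E := h.1 rfl

lemma IsExtensionBy.finite [M.Finite] (h : M.IsExtensionBy N {e}) : N.Finite :=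
  ⟨by rw [h.ground_eq]; exact M.ground_finite.union (finite_singleton e)⟩

lemma IsExtensionBy.intRk_eq (h : M.IsExtensionBy N T) (hS : S ⊆ M.E) :
    M.intRk S = N.intRk S := by
  obtain ⟨-, rfl⟩ := h
  rw [intRk, intRk, delete_eq_restrict, restrict_eRk_eq _ (by simpa using hS)]

lemma IsExtensionBy.localConnectivity_eq (h : M.IsExtensionBy N U) (hS : S ⊆ M.E) (hT : T ⊆ M.E) :
    M.localConnectivity S T = N.localConnectivity S T := by
  rw [localConnectivity, localConnectivity, h.intRk_eq hS, h.intRk_eq hT,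
    h.intRk_eq (union_subset hS hT)]

lemma IsExtensionBy.indep_iff (h : M.IsExtensionBy N T) : M.Indep I ↔ N.Indep I ∧ Disjoint I T := by
  rw [← h.2, delete_indep_iff]

lemma IsExtensionBy.indep_iff_of_mem (h : M.IsExtensionBy N {e}) (he : e ∈ I) :
    N.Indep I ↔ M.Indep (I \ {e}) ∧ e ∉ N.closure (I \ {e}) := by
  have hd : Disjoint (I \ {e}) {e} := disjoint_sdiff_left
  rw [h.indep_iff, and_iff_left hd]
  nth_rw 1 [← insert_sdiff_self_of_mem he]
  rw [insert_indep_iff]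
  simp [h.mem_ground]

/-- A single-element extension is determined by the sets that span the new element. -/
lemma IsExtensionBy.eq_of_forall_mem_closure_iff {N' : Matroid α} (h : M.IsExtensionBy N {e})
    (h' : M.IsExtensionBy N' {e})
    (hcl : ∀ F ⊆ M.E, (e ∈ N.closure F ↔ e ∈ N'.closure F)) : N = N' := by
  refine ext_indep (by rw [h.ground_eq, h'.ground_eq]) fun I _ ↦ ?_
  by_cases he : e ∈ I
  · rw [h.indep_iff_of_mem he, h'.indep_iff_of_mem he]
    exact and_congr_right fun hi ↦ not_congr (hcl _ hi.subset_ground)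
  · have hd : Disjoint I {e} := disjoint_singleton_right.2 he
    rw [← and_iff_left (a := N.Indep I) hd, ← h.indep_iff, h'.indep_iff, and_iff_left hd]

/-- A family of sets that is closed under supersets, depends only on closures and contains `F`
whenever it contains `F ∪ {e}` and `F ∪ {f}` and `{e, f}` has rank two over `F`, is the family of
sets that span the new element of some single-element extension. -/
theorem exists_isExtensionBy_singleton [M.Finite] (he : e ∉ M.E) (C : Set α → Prop)
    (hmono : ∀ F G, F ⊆ G → G ⊆ M.E → C F → C G)
    (hclosure : ∀ F ⊆ M.E, ∀ f ∈ M.E, M.intRk (insert f F) = M.intRk F → C (insert f F) → C F)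
    (hmod : ∀ F ⊆ M.E, ∀ f ∈ M.E, ∀ g ∈ M.E, M.intRk (insert f (insert g F)) = M.intRk F + 2 →
      C (insert f F) → C (insert g F) → C F) :
    ∃ N, M.IsExtensionBy N {e} ∧ ∀ F ⊆ M.E, (e ∈ N.closure F ↔ C F) := by
  -- Invariance under one spanned element gives invariance under closure, by peeling off the finite
  -- set `G` one element at a time.
  have hclosure' : ∀ F G, F ⊆ M.E → G ⊆ M.E → G ⊆ M.closure F → C G → C F := by
    intro F G hF hG hGF hC
    suffices h : ∀ K : Set α, K.Finite → K ⊆ M.closure F → C (K ∪ F) → C F from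
      h G (M.ground_finite.subset hG) hGF
        (hmono _ _ subset_union_left (union_subset hG hF) hC)
    intro K hK
    induction K, hK using Set.Finite.induction_on with
    | empty => simp
    | @insert a K _ _ ih =>
      intro hKF hC
      rw [insert_subset_iff] at hKF
      refine ih hKF.2 (hclosure (K ∪ F) (union_subset
        (hKF.2.trans (M.closure_subset_ground F)) hF) a
        (M.closure_subset_ground F hKF.1) (intRk_insert_of_mem_closure ?_) ?_)
      · exact M.closure_subset_closure subset_union_right hKF.1
      · rwa [← insert_union]
  -- The independent sets of the extension: `e` may join an independent set exactly when that set is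
  -- not to span `e`.
  let P : Set α → Prop := fun I ↦ M.Indep (I \ {e}) ∧ (e ∈ I → ¬ C (I \ {e}))
  have hP : ∀ I, e ∉ I → (P I ↔ M.Indep I) := by
    intro I hI
    simp [P, hI]
  have hPi : ∀ I, e ∉ I → (P (insert e I) ↔ M.Indep I ∧ ¬ C I) := by
    intro I hI
    simp [P, hI]
  have hind : ∀ I, M.Indep I → e ∉ I := fun I hI heI ↦ he (hI.subset_ground heI)
  have hfin : ∀ I, M.Indep I → I.Finite := fun I hI ↦ M.ground_finite.subset hI.subset_ground
  have haug : ∀ I J, M.Indep I → M.Indep J → I.ncard < J.ncard →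
      ∃ f ∈ J, f ∉ I ∧ M.Indep (insert f I) := by
    intro I J hI hJ hlt
    obtain ⟨f, hf, hfI⟩ := hI.exists_insert_of_encard_lt hJ (by
      rw [← (hfin I hI).cast_ncard_eq, ← (hfin J hJ).cast_ncard_eq]
      exact_mod_cast hlt)
    exact ⟨f, hf.1, hf.2, hfI⟩
  have hins : ∀ I f, M.Indep I → f ∉ I → (insert f I).ncard = I.ncard + 1 :=
    fun I f hI hf ↦ ncard_insert_of_notMem hf (hfin I hI)
  have hspan : ∀ I J, M.Indep I → M.Indep J → (∀ f ∈ J, f ∉ I → ¬ M.Indep (insert f I)) →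
      J ⊆ M.closure I := by
    intro I J hI hJ h f hf
    by_contra hcl
    exact h f hf (fun hfI ↦ hcl (M.mem_closure_of_mem hfI hI.subset_ground))
      (hI.insert_indep_iff.2 (.inl ⟨hJ.subset_ground hf, hcl⟩))
  have hspan' : ∀ I J, M.Indep I → M.Indep J → J ⊆ M.closure I → I.ncard ≤ J.ncard →
      I ⊆ M.closure J := by
    intro I J hI hJ hJI hle
    refine hspan J I hJ hI fun f hf hfJ hind' ↦ ?_
    have h1 := M.intRk_mono (insert_subset (M.mem_closure_of_mem hf hI.subset_ground) hJI)
    rw [intRk_closure, hind'.intRk_eq_ncard, hI.intRk_eq_ncard, hins J f hJ hfJ] at h1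
    push_cast at h1
    omega
  have hmod' : ∀ I f g, M.Indep (insert f (insert g I)) → f ∉ insert g I → g ∉ I →
      C (insert f I) → C (insert g I) → C I := by
    intro I f g hi hf hg
    have hgi := hi.subset (subset_insert _ _)
    have hI := hgi.subset (subset_insert _ _)
    refine hmod I hI.subset_ground f (hi.subset_ground (mem_insert _ _)) g
      (hgi.subset_ground (mem_insert _ _)) ?_
    rw [hi.intRk_eq_ncard, hI.intRk_eq_ncard, hins _ _ hgi hf, hins _ _ hI hg]
    push_cast
    ring
  have hPaug : ∀ ⦃I J⦄, P I → P J → I.ncard < J.ncard → ∃ f ∈ J, f ∉ I ∧ P (insert f I) := by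
    intro I J hPI hPJ hlt
    by_cases heI : e ∈ I
    · obtain ⟨I, heI', rfl⟩ : ∃ I', e ∉ I' ∧ insert e I' = I :=
        ⟨I \ {e}, by simp, insert_sdiff_self_of_mem heI⟩
      rw [hPi I heI'] at hPI
      obtain ⟨hI, hCI⟩ := hPI
      suffices h : ∃ f ∈ J, f ≠ e ∧ f ∉ I ∧ M.Indep (insert f I) ∧ ¬ C (insert f I) by
        obtain ⟨f, hfJ, hfe, hfI, hf, hfC⟩ := h
        refine ⟨f, hfJ, by simp [hfe, hfI], ?_⟩
        rw [insert_comm, hPi _ (by simp [heI', hfe.symm])]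
        exact ⟨hf, hfC⟩
      by_cases heJ : e ∈ J
      · obtain ⟨J, heJ', rfl⟩ : ∃ J', e ∉ J' ∧ insert e J' = J :=
          ⟨J \ {e}, by simp, insert_sdiff_self_of_mem heJ⟩
        rw [hPi J heJ'] at hPJ
        obtain ⟨hJ, hCJ⟩ := hPJ
        rw [hins I e hI heI', hins J e hJ heJ'] at hlt
        obtain ⟨f, hfJ, hfI, hf⟩ := haug I J hI hJ (by omega)
        -- If every admissible element put `I` into the cut, a further `g ∈ J` independent over
        -- `insert f I` would force `C I` by modularity. So `insert f I` spans `J`; the sizes make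
        -- the closures agree, and `C J` follows.
        by_contra! hall
        have hne : ∀ g ∈ J, g ≠ e := fun g hg h ↦ heJ' (h ▸ hg)
        have hCf := hall f (.inr hfJ) (hne f hfJ) hfI hf
        refine hCJ (hclosure' J _ hJ.subset_ground hf.subset_ground
          (hspan' _ _ hf hJ (hspan _ _ hf hJ ?_) (by rw [hins I f hI hfI]; omega)) hCf)
        intro g hgJ hgI hg
        have hgI' : g ∉ I := fun h ↦ hgI (.inr h)
        exact hCI (hmod' I g f hg hgI hfI (hall g (.inr hgJ) (hne g hgJ) hgI'
          (hg.subset (insert_subset_insert (subset_insert _ _)))) hCf)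
      · rw [hP J heJ] at hPJ
        rw [hins I e hI heI'] at hlt
        -- Here `J` exceeds the old part of `I` by at least two, so two elements `f`, `g` are
        -- available; by modularity they cannot both lead into the cut.
        obtain ⟨f, hfJ, hfI, hf⟩ := haug I J hI hPJ (by omega)
        obtain ⟨g, hgJ, hgI, hg⟩ := haug _ J hf hPJ (by rw [hins I f hI hfI]; omega)
        have hne : ∀ g ∈ J, g ≠ e := fun g hg h ↦ heJ (h ▸ hg)
        by_cases hCf : C (insert f I)
        · refine ⟨g, hgJ, hne g hgJ, fun h ↦ hgI (.inr h),
            hg.subset (insert_subset_insert (subset_insert _ _)), fun hCg ↦ ?_⟩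
          exact hCI (hmod' I g f hg hgI hfI hCg hCf)
        · exact ⟨f, hfJ, hne f hfJ, hfI, hf, hCf⟩
    · rw [hP I heI] at hPI
      by_cases heJ : e ∈ J
      · obtain ⟨J, heJ', rfl⟩ : ∃ J', e ∉ J' ∧ insert e J' = J :=
          ⟨J \ {e}, by simp, insert_sdiff_self_of_mem heJ⟩
        rw [hPi J heJ'] at hPJ
        obtain ⟨hJ, hCJ⟩ := hPJ
        rw [hins J e hJ heJ'] at hlt
        by_cases h : ∃ f ∈ J, f ∉ I ∧ M.Indep (insert f I)
        · obtain ⟨f, hfJ, hfI, hf⟩ := h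
          exact ⟨f, .inr hfJ, hfI, (hP _ (hind _ hf)).2 hf⟩
        · push Not at h
          -- When no old element augments, `I` and the old part of `J` have the same closure, so `e`
          -- is as free over `I` as over `J`.
          refine ⟨e, .inl rfl, heI, (hPi I heI).2 ⟨hPI, fun hCI ↦ hCJ ?_⟩⟩
          exact hclosure' J I hJ.subset_ground hPI.subset_ground
            (hspan' I J hPI hJ (hspan I J hPI hJ h) (by omega)) hCI
      · rw [hP J heJ] at hPJ
        obtain ⟨f, hfJ, hfI, hf⟩ := haug I J hPI hPJ hlt
        exact ⟨f, hfJ, hfI, (hP _ (hind _ hf)).2 hf⟩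
  let N := (IndepMatroid.ofFinite (M.ground_finite.insert e) P
    ⟨by simp, by simp⟩
    (fun I J hJ hIJ ↦ ⟨hJ.1.subset (sdiff_subset_sdiff_left hIJ), fun heI hC ↦ hJ.2 (hIJ heI)
      (hmono _ _ (sdiff_subset_sdiff_left hIJ) hJ.1.subset_ground hC)⟩)
    hPaug
    (fun I hI ↦ by simpa [sdiff_singleton_subset_iff] using hI.1.subset_ground)).matroid
  have hNE : N.E = insert e M.E := rfl
  have hNI : ∀ I, N.Indep I ↔ P I := fun I ↦ Iff.rfl
  have hext : M.IsExtensionBy N {e} := by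
    refine ⟨by simp [hNE], ext_indep (by simp [hNE, he]) fun I _ ↦ ?_⟩
    rw [delete_indep_iff, hNI, disjoint_singleton_right]
    exact ⟨fun h ↦ (hP I h.2).1 h.1, fun h ↦ ⟨(hP I (hind I h)).2 h, hind I h⟩⟩
  refine ⟨N, hext, fun F hF ↦ ?_⟩
  obtain ⟨I, hIF⟩ := M.exists_isBasis F
  have heI := hind I hIF.indep
  have hNIF : N.closure I = N.closure F := by
    have hIN := hIF
    rw [← hext.2] at hIN
    exact hIN.of_delete.closure_eq_closure
  have hNindep : N.Indep I := (hP I heI).2 hIF.indep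
  have hins' := hPi I heI
  rw [← hNI, hNindep.insert_indep_iff, and_iff_right hIF.indep, or_iff_left heI, mem_sdiff,
    and_iff_right hext.mem_ground, not_iff_not] at hins'
  rw [← hNIF, hins']
  exact ⟨hmono _ _ hIF.subset hF,
    hclosure' I F hIF.indep.subset_ground hF hIF.subset_closure⟩

end Extension

/-! ### Connectivity and a commonly spanned point -/

section InsertRank

lemma localConnectivity_insert_insert (M : Matroid α) (e : α) (F G : Set α) :
    M.localConnectivity (insert e F) (insert e G) =
      M.intRk (insert e F) + M.intRk (insert e G) - M.intRk (insert e (F ∪ G)) := by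
  rw [localConnectivity, insert_union, union_insert, insert_idem]

/-- After `e` is added to both sets at no cost in rank, their intersection has rank at least one,
and submodularity applies. -/
lemma one_le_localConnectivity_of_mem_closure [M.RankFinite] (he : M.IsNonloop e)
    (hF : e ∈ M.closure F) (hG : e ∈ M.closure G) : 1 ≤ M.localConnectivity F G := by
  have h := M.intRk_submod (I := {e}) (U := F ∪ G) (S := insert e F) (T := insert e G)
    (by simp) (by grind)
  rw [he.intRk_eq, intRk_insert_of_mem_closure hF, intRk_insert_of_mem_closure hG] at h
  unfold localConnectivity
  linarith

/-- An element spanned by a set `T ⊆ B` whose connectivity to `A` is one is spanned by a subset `F`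
of `A` precisely when `F` and `T` are not skew. -/
lemma mem_closure_iff_one_le_localConnectivity [M.RankFinite] (he : M.IsNonloop e)
    (hA : e ∈ M.closure A) (hT : e ∈ M.closure T) (hAT : M.localConnectivity A T = 1)
    (hF : F ⊆ A) : e ∈ M.closure F ↔ 1 ≤ M.localConnectivity F T := by
  refine ⟨fun h ↦ one_le_localConnectivity_of_mem_closure he h hT, fun h ↦ ?_⟩
  refine mem_closure_of_intRk_insert_le he.mem_ground ?_
  have h1 := M.localConnectivity_mono_left (insert_subset_insert (a := e) hF) (insert e T)
  rw [localConnectivity_insert_insert, localConnectivity_insert_insert,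
    intRk_insert_of_mem_closure hT, intRk_insert_of_mem_closure hA,
    intRk_insert_of_mem_closure (M.closure_subset_closure subset_union_right hT),
    intRk_insert_of_mem_closure (M.closure_subset_closure subset_union_right hT)] at h1
  unfold localConnectivity at hAT h
  linarith

end InsertRank

/-! ### Points in the guts of a 3-separation -/

section Guts

/-- `S ⊆ A` and `T ⊆ B` are non-skew sets, each of connectivity one to the other side of
the pair `(A, B)` of disjoint sets of connectivity two. -/
structure IsGutsPair (M : Matroid α) (A B S T : Set α) : Prop where
  disjoint : Disjoint A B
  left_subset : S ⊆ A
  right_subset : T ⊆ B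
  conn_eq : M.localConnectivity A B = 2
  left_conn_eq : M.localConnectivity S B = 1
  right_conn_eq : M.localConnectivity A T = 1
  pair_conn_eq : M.localConnectivity S T = 1

lemma IsGutsPair.symm (h : M.IsGutsPair A B S T) : M.IsGutsPair B A T S where
  disjoint := h.disjoint.symm
  left_subset := h.right_subset
  right_subset := h.left_subset
  conn_eq := by rw [localConnectivity_comm, h.conn_eq]
  left_conn_eq := by rw [localConnectivity_comm, h.right_conn_eq]
  right_conn_eq := by rw [localConnectivity_comm, h.left_conn_eq]
  pair_conn_eq := by rw [localConnectivity_comm, h.pair_conn_eq]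

/-- The condition on `F ⊆ A` and `G ⊆ B` for `F ∪ G` to span a point that
lies on both `S` and `T`. -/
def SpansGuts (M : Matroid α) (A B S T F G : Set α) : Prop :=
  M.intRk (F ∪ B) + M.intRk (A ∪ G) ≤ M.intRk (F ∪ G) + M.intRk (A ∪ B) ∨
    1 ≤ M.localConnectivity F T ∨ 1 ≤ M.localConnectivity S G

lemma SpansGuts.symm (h : M.SpansGuts A B S T F G) : M.SpansGuts B A T S G F := by
  unfold SpansGuts at *
  rw [union_comm G A, union_comm B F, union_comm G F, union_comm B A, add_comm (M.intRk (A ∪ G)),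
    localConnectivity_comm M G, localConnectivity_comm M T, or_comm (b := 1 ≤ _)]
  exact h

/-- Non-skewness is transitive among the pairs of `A`-sides and `B`-sides that involve `(S, T)`. -/
def GutsCompatible (M : Matroid α) (A B S T : Set α) : Prop :=
  ∀ F ⊆ A, ∀ G ⊆ B, M.localConnectivity F B = 1 → M.localConnectivity A G = 1 →
    (M.localConnectivity F T = 1 → M.localConnectivity S G = 1 → M.localConnectivity F G = 1) ∧
    (M.localConnectivity F T = 1 → M.localConnectivity F G = 1 → M.localConnectivity S G = 1) ∧
    (M.localConnectivity S G = 1 → M.localConnectivity F G = 1 → M.localConnectivity F T = 1)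

lemma GutsCompatible.symm (h : M.GutsCompatible A B S T) : M.GutsCompatible B A T S := by
  intro G hG F hF hGA hFB
  rw [localConnectivity_comm] at hGA hFB
  obtain ⟨h1, h2, h3⟩ := h F hF G hG hFB hGA
  rw [localConnectivity_comm M G S, localConnectivity_comm M T F, localConnectivity_comm M G F]
  exact ⟨fun hs ht ↦ h1 ht hs, h3, h2⟩

/-- If `F ∪ G` spans `e` but neither part does, adding `e` to both raises their connectivity by two,
up to the maximum 2. So `F` and `G` are skew, while each has connectivity at least one to the
opposite side; this is the modular-pair inequality. Conversely, `e` lies in the closures of both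
members of the modular pair. -/
lemma IsGutsPair.mem_closure_union_iff [M.RankFinite] (h : M.IsGutsPair A B S T)
    (he : M.IsNonloop e) (hS : e ∈ M.closure S) (hT : e ∈ M.closure T) (hF : F ⊆ A) (hG : G ⊆ B) :
    e ∈ M.closure (F ∪ G) ↔ M.SpansGuts A B S T F G := by
  have hA : e ∈ M.closure A := M.closure_subset_closure h.left_subset hS
  have hB : e ∈ M.closure B := M.closure_subset_closure h.right_subset hT
  have hFT := mem_closure_iff_one_le_localConnectivity he hA hT h.right_conn_eq hF
  have hGS := mem_closure_iff_one_le_localConnectivity he hB hS h.symm.right_conn_eq hG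
  rw [localConnectivity_comm M G] at hGS
  have hFB := M.closure_subset_closure subset_union_right hB (X := B) (Y := F ∪ B)
  have hAG := M.closure_subset_closure subset_union_left hA (X := A) (Y := A ∪ G)
  have hAB := M.closure_subset_closure subset_union_left hA (X := A) (Y := A ∪ B)
  constructor
  · intro hFG
    by_contra hcon
    simp only [SpansGuts, ← hFT, ← hGS, not_or] at hcon
    obtain ⟨hk, hnF, hnG⟩ := hcon
    have h1 := M.localConnectivity_mono_right (insert e F) (insert_subset_insert (a := e) hG)
    have h2 := M.localConnectivity_mono_left (insert_subset_insert (a := e) hF) (insert e G)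
    have h3 := M.localConnectivity_mono (insert_subset_insert (a := e) hF)
      (insert_subset_insert (a := e) hG)
    have h0 := M.localConnectivity_nonneg F G
    have hc := h.conn_eq
    simp only [localConnectivity_insert_insert, intRk_insert_of_mem_closure hA,
      intRk_insert_of_mem_closure hB, intRk_insert_of_mem_closure hFB,
      intRk_insert_of_mem_closure hAG, intRk_insert_of_mem_closure hAB,
      intRk_insert_of_mem_closure hFG, intRk_insert_of_notMem_closure he.mem_ground hnF,
      intRk_insert_of_notMem_closure he.mem_ground hnG] at h1 h2 h3
    simp only [localConnectivity] at h0 hc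
    omega
  · rintro (hk | hk | hk)
    · refine mem_closure_of_intRk_insert_le he.mem_ground ?_
      have h1 := M.intRk_submod (I := insert e (F ∪ G)) (U := A ∪ B) (S := insert e (F ∪ B))
        (T := insert e (A ∪ G)) (by grind) (by grind)
      rw [intRk_insert_of_mem_closure hFB, intRk_insert_of_mem_closure hAG] at h1
      omega
    · exact M.closure_subset_closure subset_union_left (hFT.2 hk)
    · exact M.closure_subset_closure subset_union_right (hGS.2 hk)

/-- Being non-skew to `T`, or to `S`, amounts to spanning `e`. If `F` spans `e`, is non-skew to `G`,
and `G` misses `e`, then adding `e` to `G` raises their connectivity to 2, more than `F` has with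
all of `B`. -/
lemma IsGutsPair.gutsCompatible [M.RankFinite] (h : M.IsGutsPair A B S T)
    (he : M.IsNonloop e) (hS : e ∈ M.closure S) (hT : e ∈ M.closure T) :
    M.GutsCompatible A B S T := by
  intro F hF G hG hFB hAG
  have hA : e ∈ M.closure A := M.closure_subset_closure h.left_subset hS
  have hB : e ∈ M.closure B := M.closure_subset_closure h.right_subset hT
  have hFT := mem_closure_iff_one_le_localConnectivity he hA hT h.right_conn_eq hF
  have hGS := mem_closure_iff_one_le_localConnectivity he hB hS h.symm.right_conn_eq hG
  rw [localConnectivity_comm M G] at hGS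
  have h1 := M.localConnectivity_mono_right F hG
  have h2 := M.localConnectivity_mono_left hF T
  have h3 := M.localConnectivity_mono_right S hG
  have h4 := h.left_conn_eq
  have h5 := h.right_conn_eq
  have hFB' := M.closure_subset_closure subset_union_right hB (X := B) (Y := F ∪ B)
  have hAG' := M.closure_subset_closure subset_union_left hA (X := A) (Y := A ∪ G)
  refine ⟨fun h6 h7 ↦ ?_, fun h6 h7 ↦ ?_, fun h6 h7 ↦ ?_⟩
  · have := one_le_localConnectivity_of_mem_closure he (hFT.2 h6.ge) (hGS.2 h7.ge)
    omega
  · suffices e ∈ M.closure G by have := hGS.1 this; omega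
    by_contra hnG
    have heF := hFT.2 h6.ge
    have h8 := M.localConnectivity_mono_right (insert e F) (insert_subset_insert (a := e) hG)
    rw [localConnectivity_insert_insert, localConnectivity_insert_insert,
      intRk_insert_of_mem_closure heF, intRk_insert_of_mem_closure hB,
      intRk_insert_of_mem_closure hFB', intRk_insert_of_notMem_closure he.mem_ground hnG,
      intRk_insert_of_mem_closure (M.closure_subset_closure subset_union_left heF)] at h8
    unfold localConnectivity at h7 hFB
    omega
  · suffices e ∈ M.closure F by have := hFT.1 this; omega
    by_contra hnF
    have heG := hGS.2 h6.ge
    have h8 := M.localConnectivity_mono_left (insert_subset_insert (a := e) hF) (insert e G)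
    rw [localConnectivity_insert_insert, localConnectivity_insert_insert,
      intRk_insert_of_mem_closure heG, intRk_insert_of_mem_closure hA,
      intRk_insert_of_mem_closure hAG', intRk_insert_of_notMem_closure he.mem_ground hnF,
      intRk_insert_of_mem_closure (M.closure_subset_closure subset_union_right heG)] at h8
    unfold localConnectivity at h7 hAG
    omega

/-- Only the clause `⊓(F, T)` can newly become true, and then `e` raises the connectivity of `F` to
both `B` and `G` by one. If `F` was skew to `B`, compatibility forces `G` to be non-skew to `S`;
otherwise `insert e F` is as connected as `A`, and the modular-pair clause already held. -/
lemma SpansGuts.of_insert_left [M.RankFinite] (h : M.IsGutsPair A B S T)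
    (hcomp : M.GutsCompatible A B S T) (hF : F ⊆ A) (hG : G ⊆ B) (he : e ∈ A)
    (hr : M.intRk (insert e F ∪ G) = M.intRk (F ∪ G)) (hD : M.SpansGuts A B S T (insert e F) G) :
    M.SpansGuts A B S T F G := by
  by_contra hcon
  simp only [SpansGuts, not_or] at hcon hD
  have heF : insert e F ⊆ A := insert_subset he hF
  have c1 := h.conn_eq
  have c2 := h.left_conn_eq
  have c3 := h.right_conn_eq
  have s1 := M.intRk_submod (I := F ∪ G) (U := insert e F ∪ B) (S := insert e F ∪ G) (T := F ∪ B)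
    (by grind) (by grind)
  have s2 := M.intRk_mono (S := F ∪ B) (T := insert e F ∪ B) (by grind)
  have s3 := M.intRk_insert_le e F
  have s4 := M.le_intRk_insert e F
  have s5 := M.intRk_submod (I := F) (U := insert e F ∪ T) (S := insert e F) (T := F ∪ T)
    (by grind) (by grind)
  have m1 := M.localConnectivity_mono_left heF B
  have m2 := M.localConnectivity_mono_left heF T
  have m3 := M.localConnectivity_mono_right S hG
  have m4 := M.localConnectivity_mono_left hF G
  have m5 := M.localConnectivity_mono_right F hG
  have n1 := M.localConnectivity_nonneg F G
  have n2 := M.localConnectivity_nonneg F B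
  have s6 := M.intRk_mono (S := F ∪ T) (T := insert e F ∪ T) (by grind)
  have m6 := M.localConnectivity_mono_left heF G
  have e1 := localConnectivity_eq_of_subset (M := M) heF hG
  have e2 := (hcomp _ heF G hG · · |>.2.1)
  simp only [localConnectivity] at *
  have hrank : M.intRk (insert e F) = M.intRk F + 1 := by omega
  by_cases hFB : M.intRk F + M.intRk B - M.intRk (F ∪ B) = 0
  · have := e2 (by omega) (by omega) (by omega) (by omega)
    omega
  · have := e1 (by omega)
    omega

/-- The modular defect of `F ∪ B` and `A ∪ G` is `2 - ⊓(F, B) - ⊓(A, G) + ⊓(F, G)`. A rank-raising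
element enters the cut either by closing a defect of one inside the closure of `F ∪ B`, or, when the
defect is two, by making `F` meet `T`. -/
lemma IsGutsPair.intRk_eq_of_not_spansGuts [M.RankFinite] (h : M.IsGutsPair A B S T)
    (hF : F ⊆ A) (hG : G ⊆ B) (he : e ∈ A)
    (hr : M.intRk (insert e F ∪ G) = M.intRk (F ∪ G) + 1) (hcon : ¬ M.SpansGuts A B S T F G)
    (hD : M.SpansGuts A B S T (insert e F) G) :
    (M.intRk (F ∪ B) + M.intRk (A ∪ G) = M.intRk (F ∪ G) + M.intRk (A ∪ B) + 1 ∧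
      M.intRk (insert e F ∪ B) = M.intRk (F ∪ B)) ∨
    (M.localConnectivity F B = 0 ∧ M.localConnectivity A G = 0 ∧
      M.localConnectivity (insert e F) T = 1 ∧ M.localConnectivity (insert e F) B = 1) := by
  simp only [SpansGuts, not_or] at hcon hD
  have heF : insert e F ⊆ A := insert_subset he hF
  have c1 := h.conn_eq
  have c3 := h.right_conn_eq
  have s1 := M.intRk_submod (I := F) (U := insert e F ∪ G) (S := insert e F) (T := F ∪ G)
    (by grind) (by grind)
  have s2 := M.intRk_mono (S := F ∪ B) (T := insert e F ∪ B) (by grind)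
  have s2' := M.intRk_insert_le e (F ∪ B)
  rw [← insert_union] at s2'
  have s3 := M.intRk_insert_le e F
  have m2 := M.localConnectivity_mono_left heF T
  have m2' := M.localConnectivity_mono_right (insert e F) h.right_subset
  have m4 := M.localConnectivity_mono_left hF G
  have m5 := M.localConnectivity_mono_right F hG
  have n1 := M.localConnectivity_nonneg F G
  have e1 := localConnectivity_eq_of_subset (M := M) (subset_insert e F) h.right_subset
  simp only [localConnectivity] at *
  by_cases hk : M.intRk (F ∪ B) + M.intRk (A ∪ G) = M.intRk (F ∪ G) + M.intRk (A ∪ B) + 1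
  · left
    refine ⟨hk, ?_⟩
    by_contra hne
    have := e1 (by omega)
    omega
  · right
    omega

/-- Both elements enter the cut in the same way, since the defects differ. With defect one, the two
elements would gain rank two inside a gap of one; with defect two, the enlarged `F` would have
connectivity 2 with `T`, although `A` has only 1. -/
lemma SpansGuts.of_insert_insert_left [M.RankFinite] (h : M.IsGutsPair A B S T)
    (hF : F ⊆ A) (hG : G ⊆ B) (he : e ∈ A) (hf : f ∈ A)
    (hr : M.intRk (insert e (insert f F) ∪ G) = M.intRk (F ∪ G) + 2)
    (heD : M.SpansGuts A B S T (insert e F) G) (hfD : M.SpansGuts A B S T (insert f F) G) :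
    M.SpansGuts A B S T F G := by
  by_contra hcon
  have r1 := M.intRk_insert_le e (F ∪ G)
  have r2 := M.intRk_insert_le f (F ∪ G)
  have r3 := M.intRk_insert_le e (insert f F ∪ G)
  have r4 := M.intRk_insert_le f (insert e F ∪ G)
  rw [← insert_union] at r1 r2 r3 r4
  rw [insert_comm] at r4
  have h1 := h.intRk_eq_of_not_spansGuts hF hG he (by omega) hcon heD
  have h2 := h.intRk_eq_of_not_spansGuts hF hG hf (by omega) hcon hfD
  simp only [SpansGuts, not_or] at hcon
  have hdis := h.disjoint
  have s1 := M.intRk_submod (I := F ∪ B) (U := insert e (insert f F) ∪ B) (S := insert e F ∪ B)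
    (T := insert f F ∪ B) (by grind) (by grind)
  have s2 := M.intRk_submod (I := insert e (insert f F) ∪ G) (U := A ∪ B)
    (S := insert e (insert f F) ∪ B) (T := A ∪ G) (by grind) (by grind)
  have s3 := M.intRk_submod (I := F) (U := insert e (insert f F) ∪ G) (S := insert e (insert f F))
    (T := F ∪ G) (by grind) (by grind)
  have s4 := M.intRk_submod (I := F ∪ T) (U := insert e (insert f F) ∪ T)
    (S := insert e F ∪ T) (T := insert f F ∪ T) (by grind) (by grind)
  have m1 := M.localConnectivity_mono_left (insert_subset he (insert_subset hf hF)) T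
  have c3 := h.right_conn_eq
  have r5 := M.intRk_insert_le e F
  have r6 := M.intRk_insert_le f F
  simp only [localConnectivity] at *
  omega

/-- Defect one fails by rank, as for two elements on one side. With defect two, compatibility makes
the enlarged sets non-skew, whereas a rank gain of two keeps them skew. This is where the
transitivity `F`–`T`–`S`–`G` is needed. -/
lemma SpansGuts.of_insert_left_of_insert_right [M.RankFinite] (h : M.IsGutsPair A B S T)
    (hcomp : M.GutsCompatible A B S T) (hF : F ⊆ A) (hG : G ⊆ B) (he : e ∈ A) (hf : f ∈ B)
    (hr : M.intRk (insert e F ∪ insert f G) = M.intRk (F ∪ G) + 2)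
    (heD : M.SpansGuts A B S T (insert e F) G) (hfD : M.SpansGuts A B S T F (insert f G)) :
    M.SpansGuts A B S T F G := by
  by_contra hcon
  have r1 := M.intRk_insert_le e (F ∪ G)
  have r2 := M.intRk_insert_le f (F ∪ G)
  have r3 := M.intRk_insert_le e (F ∪ insert f G)
  have r4 := M.intRk_insert_le f (insert e F ∪ G)
  rw [← union_insert] at r2 r4
  rw [← insert_union] at r1 r3
  have h1 := h.intRk_eq_of_not_spansGuts hF hG he (by omega) hcon heD
  have h2 := h.symm.intRk_eq_of_not_spansGuts hG hF hf
    (by rw [union_comm, union_comm G]; omega) (fun hD ↦ hcon hD.symm) hfD.symm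
  rw [union_comm G A, union_comm B F, union_comm G F, union_comm B A, union_comm (insert f G) A,
    M.localConnectivity_comm G A, M.localConnectivity_comm B F,
    M.localConnectivity_comm (insert f G) S, M.localConnectivity_comm (insert f G) A] at h2
  simp only [SpansGuts, not_or] at hcon
  have hdis := h.disjoint
  have s1 := M.intRk_submod (I := insert e F ∪ insert f G) (U := A ∪ B) (S := insert e F ∪ B)
    (T := A ∪ insert f G) (by grind) (by grind)
  have e1 := (hcomp _ (insert_subset he hF) _ (insert_subset hf hG) · · |>.1)
  have r5 := M.intRk_insert_le e F
  have r6 := M.intRk_insert_le f G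
  have m1 := M.localConnectivity_nonneg F G
  have m2 := M.localConnectivity_mono_right F hG
  rcases h1 with h1 | ⟨h1, h1', h1'', h1'''⟩
  · simp only [localConnectivity] at *
    omega
  · have := e1 h1''' (by simp only [localConnectivity] at *; omega) h1''
      (by simp only [localConnectivity] at *; omega)
    simp only [localConnectivity] at *
    omega

/-- A compatible guts pair on a partition of the ground set supports a single-element extension
in which the new element is spanned by both members of the pair. -/
theorem IsGutsPair.exists_isExtensionBy [M.Finite] (h : M.IsGutsPair A B S T) (hE : A ∪ B = M.E)
    (hcomp : M.GutsCompatible A B S T) (he : e ∉ M.E) :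
    ∃ N, M.IsExtensionBy N {e} ∧
      ∀ F ⊆ M.E, (e ∈ N.closure F ↔ M.SpansGuts A B S T (F ∩ A) (F ∩ B)) := by
  have hd := h.disjoint
  have hsplit : ∀ F ⊆ M.E, F = F ∩ A ∪ F ∩ B := by
    intro F hF
    rw [← inter_union_distrib_left, hE, inter_eq_left.2 hF]
  have hinsA : ∀ f ∈ A, ∀ F, insert f F ∩ A = insert f (F ∩ A) ∧ insert f F ∩ B = F ∩ B := by
    intro f hf F
    exact ⟨insert_inter_of_mem hf, insert_inter_of_notMem (hd.notMem_of_mem_left hf)⟩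
  have hinsB : ∀ f ∈ B, ∀ F, insert f F ∩ A = F ∩ A ∧ insert f F ∩ B = insert f (F ∩ B) := by
    intro f hf F
    exact ⟨insert_inter_of_notMem (hd.notMem_of_mem_right hf), insert_inter_of_mem hf⟩
  refine exists_isExtensionBy_singleton he (fun F ↦ M.SpansGuts A B S T (F ∩ A) (F ∩ B)) ?_ ?_ ?_
  · intro F G hFG hG hF
    have h1 : F ∩ A ⊆ G ∩ A := inter_subset_inter_left A hFG
    have h2 : F ∩ B ⊆ G ∩ B := inter_subset_inter_left B hFG
    rcases hF with hF | hF | hF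
    · left
      -- The modular defect does not grow when the `A`-part is enlarged, nor when the `B`-part is
      -- enlarged afterwards.
      have s1 := M.intRk_submod (I := (F ∩ A) ∪ (F ∩ B)) (U := (G ∩ A) ∪ (F ∩ B) ∪ ((F ∩ A) ∪ B))
        (S := (G ∩ A) ∪ (F ∩ B)) (T := (F ∩ A) ∪ B) (by grind) (by grind)
      have s2 := M.intRk_mono (S := (G ∩ A) ∪ B) (T := (G ∩ A) ∪ (F ∩ B) ∪ ((F ∩ A) ∪ B)) (by grind)
      have s3 := M.intRk_submod (I := (G ∩ A) ∪ (F ∩ B)) (U := A ∪ (G ∩ B))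
        (S := (G ∩ A) ∪ (G ∩ B)) (T := A ∪ (F ∩ B)) (by grind) (by grind)
      omega
    · exact .inr (.inl (hF.trans (M.localConnectivity_mono_left h1 T)))
    · exact .inr (.inr (hF.trans (M.localConnectivity_mono_right S h2)))
  · intro F hF f hf hr hD
    have hfE := insert_subset hf hF
    replace hr : M.intRk (insert f F ∩ A ∪ insert f F ∩ B) = M.intRk (F ∩ A ∪ F ∩ B) := by
      rw [← hsplit F hF, ← hsplit _ hfE, hr]
    rw [← hE] at hf
    rcases hf with hf | hf
    · rw [(hinsA f hf F).1, (hinsA f hf F).2] at hr hD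
      exact .of_insert_left h hcomp inter_subset_right inter_subset_right hf hr hD
    · rw [(hinsB f hf F).1, (hinsB f hf F).2] at hr hD
      rw [union_comm, union_comm (F ∩ A)] at hr
      exact (SpansGuts.of_insert_left h.symm hcomp.symm inter_subset_right inter_subset_right
        hf hr hD.symm).symm
  · intro F hF f hf g hg hr hfD hgD
    have hfE := insert_subset hf (insert_subset hg hF)
    replace hr : M.intRk (insert f (insert g F) ∩ A ∪ insert f (insert g F) ∩ B) =
        M.intRk (F ∩ A ∪ F ∩ B) + 2 := by
      rw [← hsplit F hF, ← hsplit _ hfE, hr]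
    rw [← hE] at hf hg
    rcases hf with hf | hf <;> rcases hg with hg | hg
    · rw [(hinsA f hf _).1, (hinsA f hf _).2, (hinsA g hg F).1, (hinsA g hg F).2] at hr
      rw [(hinsA f hf F).1, (hinsA f hf F).2] at hfD
      rw [(hinsA g hg F).1, (hinsA g hg F).2] at hgD
      exact .of_insert_insert_left h inter_subset_right inter_subset_right hf hg hr hfD hgD
    · rw [(hinsA f hf _).1, (hinsA f hf _).2, (hinsB g hg F).1, (hinsB g hg F).2] at hr
      rw [(hinsA f hf F).1, (hinsA f hf F).2] at hfD
      rw [(hinsB g hg F).1, (hinsB g hg F).2] at hgD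
      exact .of_insert_left_of_insert_right h hcomp inter_subset_right inter_subset_right hf hg
        hr hfD hgD
    · rw [(hinsB f hf _).1, (hinsB f hf _).2, (hinsA g hg F).1, (hinsA g hg F).2] at hr
      rw [(hinsB f hf F).1, (hinsB f hf F).2] at hfD
      rw [(hinsA g hg F).1, (hinsA g hg F).2] at hgD
      exact .of_insert_left_of_insert_right h hcomp inter_subset_right inter_subset_right hg hf
        hr hgD hfD
    · rw [(hinsB f hf _).1, (hinsB f hf _).2, (hinsB g hg F).1, (hinsB g hg F).2] at hr
      rw [(hinsB f hf F).1, (hinsB f hf F).2] at hfD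
      rw [(hinsB g hg F).1, (hinsB g hg F).2] at hgD
      rw [union_comm, union_comm (F ∩ A)] at hr
      exact (SpansGuts.of_insert_insert_left h.symm inter_subset_right inter_subset_right hf hg
        hr hfD.symm hgD.symm).symm

end Guts

/-! ### Uniqueness, strands as circuits, and passing to an extension -/

section GutsExtension

lemma IsExtensionBy.isGutsPair (hN : M.IsExtensionBy N U) (h : M.IsGutsPair A B S T)
    (hA : A ⊆ M.E) (hB : B ⊆ M.E) : N.IsGutsPair A B S T where
  disjoint := h.disjoint
  left_subset := h.left_subset
  right_subset := h.right_subset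
  conn_eq := by rw [← hN.localConnectivity_eq hA hB, h.conn_eq]
  left_conn_eq := by
    rw [← hN.localConnectivity_eq (h.left_subset.trans hA) hB, h.left_conn_eq]
  right_conn_eq := by
    rw [← hN.localConnectivity_eq hA (h.right_subset.trans hB), h.right_conn_eq]
  pair_conn_eq := by
    rw [← hN.localConnectivity_eq (h.left_subset.trans hA) (h.right_subset.trans hB),
      h.pair_conn_eq]

lemma IsExtensionBy.spansGuts_iff (hN : M.IsExtensionBy N U) (h : M.IsGutsPair A B S T)
    (hA : A ⊆ M.E) (hB : B ⊆ M.E) (hF : F ⊆ A) (hG : G ⊆ B) :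
    M.SpansGuts A B S T F G ↔ N.SpansGuts A B S T F G := by
  have hF' := hF.trans hA
  have hG' := hG.trans hB
  rw [SpansGuts, SpansGuts, hN.intRk_eq (union_subset hF' hB), hN.intRk_eq (union_subset hA hG'),
    hN.intRk_eq (union_subset hF' hG'), hN.intRk_eq (union_subset hA hB),
    hN.localConnectivity_eq hF' (h.right_subset.trans hB),
    hN.localConnectivity_eq (h.left_subset.trans hA) hG']

/-- A guts pair of a partition of the ground set determines the single-element extension by a
point spanned by both of its members. -/
theorem IsGutsPair.extension_unique [M.Finite] {N' : Matroid α} (h : M.IsGutsPair A B S T)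
    (hE : A ∪ B = M.E) (hN : M.IsExtensionBy N {e}) (hN' : M.IsExtensionBy N' {e})
    (he : N.IsNonloop e) (hS : e ∈ N.closure S) (hT : e ∈ N.closure T)
    (he' : N'.IsNonloop e) (hS' : e ∈ N'.closure S) (hT' : e ∈ N'.closure T) : N = N' := by
  have := hN.finite
  have := hN'.finite
  have hA : A ⊆ M.E := hE ▸ subset_union_left
  have hB : B ⊆ M.E := hE ▸ subset_union_right
  refine hN.eq_of_forall_mem_closure_iff hN' fun F hF ↦ ?_
  rw [show F = F ∩ A ∪ F ∩ B by rw [← inter_union_distrib_left, hE, inter_eq_left.2 hF],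
    (hN.isGutsPair h hA hB).mem_closure_union_iff he hS hT inter_subset_right inter_subset_right,
    (hN'.isGutsPair h hA hB).mem_closure_union_iff he' hS' hT' inter_subset_right
      inter_subset_right,
    ← hN.spansGuts_iff h hA hB inter_subset_right inter_subset_right,
    ← hN'.spansGuts_iff h hA hB inter_subset_right inter_subset_right]

/-- Compatibility mentions only old elements, so it holds in `M` and can be reused after the
extension is discarded. -/
lemma IsExtensionBy.gutsCompatible [M.Finite] (hN : M.IsExtensionBy N {e})
    (h : M.IsGutsPair A B S T) (hA : A ⊆ M.E) (hB : B ⊆ M.E) (he : N.IsNonloop e)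
    (hS : e ∈ N.closure S) (hT : e ∈ N.closure T) : M.GutsCompatible A B S T := by
  have := hN.finite
  intro F hF G hG
  have hF' := hF.trans hA
  have hG' := hG.trans hB
  rw [hN.localConnectivity_eq hF' hB, hN.localConnectivity_eq hA hG',
    hN.localConnectivity_eq hF' (h.right_subset.trans hB),
    hN.localConnectivity_eq (h.left_subset.trans hA) hG', hN.localConnectivity_eq hF' hG']
  exact (hN.isGutsPair h hA hB).gutsCompatible he hS hT F hF G hG

lemma IsCircuit.mem_closure_of_insert (h : M.IsCircuit (insert e S)) (he : e ∉ S) :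
    e ∈ M.closure S := by
  simpa [he] using h.mem_closure_sdiff_singleton_of_mem (mem_insert e S)

lemma IsCircuit.isNonloop_of_insert (h : M.IsCircuit (insert e S)) (he : e ∉ S)
    (hS : S.Nonempty) : M.IsNonloop e := by
  refine h.isNonloop_of_mem ?_ (mem_insert e S)
  obtain ⟨f, hf⟩ := hS
  exact ⟨e, mem_insert e S, f, .inr hf, fun hef ↦ he (hef ▸ hf)⟩

/-- If `S` is minimal with connectivity one to `B`, then every guts point spanned by `S` completes
it to a circuit. -/
lemma isCircuit_insert_of_minimal [M.RankFinite] (he : M.IsNonloop e) (hS : e ∈ M.closure S)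
    (hB : e ∈ M.closure B) (heS : e ∉ S) (hSB : M.localConnectivity S B = 1)
    (hmin : ∀ S' ⊂ S, M.localConnectivity S' B ≠ 1) : M.IsCircuit (insert e S) := by
  obtain ⟨C, hCS, hC, heC⟩ := (mem_closure_iff_exists_isCircuit heS).1 hS
  suffices h : C = insert e S from h ▸ hC
  have hsub : C \ {e} ⊆ S := by rwa [sdiff_singleton_subset_iff]
  have h1 := one_le_localConnectivity_of_mem_closure he
    (hC.mem_closure_sdiff_singleton_of_mem heC) hB
  have h2 := M.localConnectivity_mono_left hsub B
  have h3 : ¬ C \ {e} ⊂ S := fun hss ↦ hmin _ hss (by omega)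
  rw [← (hsub.eq_or_ssubset.resolve_right h3), insert_sdiff_self_of_mem heC]

/-- A point `e` spanned by `S ⊆ A` in the guts of `(A, B)` can be replaced within any subset
of `A ∪ C`, where `C ⊆ B`, by elements of `A ∪ C`, without changing connectivities to
subsets of `B`. -/
lemma exists_forall_localConnectivity_insert_eq [M.RankFinite] {C : Set α}
    (hAB : M.localConnectivity A B = 2) (hSA : S ⊆ A) (hSB : M.localConnectivity S B = 1)
    (he : M.IsNonloop e) (hS : e ∈ M.closure S) (hB : e ∈ M.closure B) (hC : C ⊆ B)
    (hF : F ⊆ A ∪ C) :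
    ∃ F' ⊆ A ∪ C, ∀ T ⊆ B, M.localConnectivity (insert e F) T = M.localConnectivity F' T := by
  obtain ⟨P, Q, hP, hQ, rfl⟩ : ∃ P Q, P ⊆ A ∧ Q ⊆ C ∧ F = P ∪ Q :=
    ⟨F ∩ A, F ∩ C, inter_subset_right, inter_subset_right, by
      rw [← inter_union_distrib_left, inter_eq_left.2 hF]⟩
  have hQB := hQ.trans hC
  by_cases heP : e ∈ M.closure P
  · refine ⟨P ∪ Q, hF, fun T hT ↦ ?_⟩
    have h1 : e ∈ M.closure (P ∪ Q) := M.closure_subset_closure subset_union_left heP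
    rw [localConnectivity, localConnectivity, insert_union, intRk_insert_of_mem_closure h1,
      intRk_insert_of_mem_closure (M.closure_subset_closure subset_union_left h1)]
  by_cases hPB : M.localConnectivity P B ≤ 0
  · have h1 : ∀ T ⊆ B, M.intRk (insert e (P ∪ T)) = M.intRk P + M.intRk (insert e T) := by
      intro T hT
      have h2 := M.localConnectivity_nonneg P (insert e T)
      have h3 := M.localConnectivity_mono_right P (insert_subset_insert (a := e) hT)
      rw [localConnectivity, union_insert] at h2
      rw [localConnectivity, localConnectivity, union_insert, union_insert,
        intRk_insert_of_mem_closure hB, intRk_insert_of_mem_closure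
          (M.closure_subset_closure subset_union_right hB)] at h3
      unfold localConnectivity at hPB
      omega
    have h2 : ∀ T ⊆ B, M.intRk (S ∪ T) = M.intRk S - 1 + M.intRk (insert e T) := by
      intro T hT
      have heST : e ∈ M.closure (S ∪ T) := M.closure_subset_closure subset_union_left hS
      have h2 := M.localConnectivity_mono_right (insert e S) (insert_subset_insert (a := e) hT)
      have h3 := one_le_localConnectivity_of_mem_closure he
        (M.mem_closure_of_mem' (mem_insert e S) he.mem_ground)
        (M.mem_closure_of_mem' (mem_insert e T) he.mem_ground)
      rw [localConnectivity_insert_insert, intRk_insert_of_mem_closure hS,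
        intRk_insert_of_mem_closure heST] at h2 h3
      rw [localConnectivity_insert_insert, intRk_insert_of_mem_closure hS,
        intRk_insert_of_mem_closure hB, intRk_insert_of_mem_closure
          (M.closure_subset_closure subset_union_right hB)] at h2
      unfold localConnectivity at hSB
      omega
    -- With `P` skew to `B`, only `e` is visible from `B`, and `S` imitates it.
    refine ⟨S ∪ Q, union_subset_union hSA hQ, fun T hT ↦ ?_⟩
    rw [localConnectivity, localConnectivity, insert_union, union_assoc, union_assoc, h1 Q hQB,
      h1 _ (union_subset hQB hT), h2 Q hQB, h2 _ (union_subset hQB hT)]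
    ring
  · have heA : e ∈ M.closure A := M.closure_subset_closure hSA hS
    have h1 : ∀ T ⊆ B, M.intRk (insert e (P ∪ T)) - M.intRk (insert e P) =
        M.intRk (A ∪ T) - M.intRk A := by
      intro T hT
      have h2 := localConnectivity_eq_of_subset (M := M) (insert_subset_insert (a := e) hP) hT (by
        rw [localConnectivity, localConnectivity, insert_union, insert_union,
          intRk_insert_of_mem_closure heA, intRk_insert_of_mem_closure
            (M.closure_subset_closure subset_union_left heA),
          intRk_insert_of_notMem_closure he.mem_ground heP, intRk_insert_of_mem_closure
            (M.closure_subset_closure subset_union_right hB)]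
        unfold localConnectivity at hPB hAB
        omega)
      rw [localConnectivity, localConnectivity, insert_union, insert_union,
        intRk_insert_of_mem_closure heA, intRk_insert_of_mem_closure
            (M.closure_subset_closure subset_union_left heA)] at h2
      omega
    -- Here `P` together with `e` already has connectivity 2 to `B`, so `B` cannot tell it from `A`.
    refine ⟨A ∪ Q, union_subset_union_right A hQ, fun T hT ↦ ?_⟩
    have h3 := h1 Q hQB
    have h4 := h1 _ (union_subset hQB hT)
    rw [localConnectivity, localConnectivity, insert_union, union_assoc, union_assoc]
    omega

lemma localConnectivity_insert_of_mem_closure (he : e ∈ M.closure S) (T : Set α) :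
    M.localConnectivity (insert e S) T = M.localConnectivity S T := by
  rw [localConnectivity, localConnectivity, insert_union, intRk_insert_of_mem_closure he,
    intRk_insert_of_mem_closure (M.closure_subset_closure subset_union_left he)]

lemma IsGutsPair.insert (h : M.IsGutsPair A B S T) (he : e ∈ M.closure A) (heB : e ∉ B) :
    M.IsGutsPair (insert e A) B S T where
  disjoint := disjoint_insert_left.2 ⟨heB, h.disjoint⟩
  left_subset := h.left_subset.trans (subset_insert e A)
  right_subset := h.right_subset
  conn_eq := by rw [localConnectivity_insert_of_mem_closure he, h.conn_eq]
  left_conn_eq := h.left_conn_eq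
  right_conn_eq := by rw [localConnectivity_insert_of_mem_closure he, h.right_conn_eq]
  pair_conn_eq := h.pair_conn_eq

/-- Compatibility sees a subset of the left side only through its connectivities to subsets of `B`,
so replacing `e` by old elements suffices. -/
lemma GutsCompatible.insert (h : M.GutsCompatible A B S T) (he : e ∈ M.closure A) (hT : T ⊆ B)
    (hrep : ∀ F ⊆ A, ∃ F' ⊆ A, ∀ T ⊆ B,
      M.localConnectivity (insert e F) T = M.localConnectivity F' T) :
    M.GutsCompatible (insert e A) B S T := by
  intro F hF G hG
  obtain ⟨F', hF', hrep⟩ : ∃ F' ⊆ A, ∀ T ⊆ B,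
      M.localConnectivity F T = M.localConnectivity F' T := by
    by_cases heF : e ∈ F
    · have := hrep (F \ {e}) (by rwa [sdiff_singleton_subset_iff])
      rwa [insert_sdiff_self_of_mem heF] at this
    · exact ⟨F, (subset_insert_iff_of_notMem heF).1 hF, fun _ _ ↦ rfl⟩
  rw [hrep B Subset.rfl, hrep T hT, hrep G hG, localConnectivity_insert_of_mem_closure he]
  exact h F' hF' G hG

lemma IsExactThreeSeparation.isGutsPair (h : M.IsExactThreeSeparation A B)
    (hS : M.IsStrand A B S) (hT : M.IsStrand B A T) (hST : M.localConnectivity S T = 1) :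
    M.IsGutsPair A B S T where
  disjoint := h.disjoint
  left_subset := hS.prop.1
  right_subset := hT.prop.1
  conn_eq := by rw [localConnectivity, h.union_eq, h.rank_eq]
  left_conn_eq := hS.prop.2
  right_conn_eq := by rw [localConnectivity_comm, hT.prop.2]
  pair_conn_eq := hST

lemma IsGutsPair.left_nonempty (h : M.IsGutsPair A B S T) : S.Nonempty := by
  rw [nonempty_iff_ne_empty]
  rintro rfl
  simpa [localConnectivity] using h.left_conn_eq

lemma IsStrand.isCircuit_insert [N.RankFinite] (h : M.IsStrand A B S) (hN : M.IsExtensionBy N U)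
    (hA : A ⊆ M.E) (hBE : B ⊆ M.E) (he : N.IsNonloop e) (heM : e ∉ M.E) (hS : e ∈ N.closure S)
    (hB : e ∈ N.closure B) : N.IsCircuit (insert e S) := by
  have hSA := h.prop.1
  refine isCircuit_insert_of_minimal he hS hB (fun heS ↦ heM (hA (hSA heS))) ?_ fun S' hS' h1 ↦ ?_
  · rw [← hN.localConnectivity_eq (hSA.trans hA) hBE, h.prop.2]
  · have hS'A := hS'.subset.trans hSA
    rw [← hN.localConnectivity_eq (hS'A.trans hA) hBE] at h1
    exact h.not_prop_of_ssubset hS' ⟨hS'A, h1⟩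

lemma IsExtensionBy.trans {N' : Matroid α} (h : M.IsExtensionBy N {e})
    (h' : N.IsExtensionBy N' {f}) : M.IsExtensionBy N' {e, f} := by
  refine ⟨?_, ?_⟩
  · rw [pair_subset_iff]
    exact ⟨by rw [h'.ground_eq]; exact .inl h.mem_ground, h'.mem_ground⟩
  · rw [pair_comm, ← singleton_union, ← delete_delete, h'.2, h.2]

lemma IsExtensionBy.of_delete_right (h : M.IsExtensionBy N {e, f}) (hef : e ≠ f) :
    M.IsExtensionBy (N ＼ {f}) {e} ∧ (N ＼ {f}).IsExtensionBy N {f} := by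
  have h1 := pair_subset_iff.1 h.1
  refine ⟨⟨by simpa [hef] using h1.1, ?_⟩, ⟨by simpa using h1.2, rfl⟩⟩
  rw [delete_delete, singleton_union, pair_comm, h.2]

end GutsExtension

end Matroid

/-! ### Adding both points -/

open Matroid

theorem theorem1p2 {α : Type*} (M : Matroid α) [M.Finite]
    (X Y Z : Set α)
    (hE : X ∪ Y ∪ Z = M.E) (hXY : Disjoint X Y) (hXZ : Disjoint X Z) (hYZ : Disjoint Y Z)
    (hsep₁ : M.IsExactThreeSeparation X (Y ∪ Z))
    (hsep₂ : M.IsExactThreeSeparation (X ∪ Y) Z)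
    (p q : α) (hpq : p ≠ q)
    (X₀ Y₀ : Set α)
    (hX₀ : M.IsStrand X (Y ∪ Z) X₀) (hY₀ : M.IsStrand (Y ∪ Z) X Y₀)
    (h₀ : M.localConnectivity X₀ Y₀ = 1)
    (hp : ∃ N : Matroid α, M.IsExtensionBy N {p} ∧
      N.IsCircuit (insert p X₀) ∧ N.IsCircuit (insert p Y₀))
    (Y₁ Z₁ : Set α)
    (hY₁ : M.IsStrand (X ∪ Y) Z Y₁) (hZ₁ : M.IsStrand Z (X ∪ Y) Z₁)
    (h₁ : M.localConnectivity Y₁ Z₁ = 1)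
    (hq : ∃ N : Matroid α, M.IsExtensionBy N {q} ∧
      N.IsCircuit (insert q Y₁) ∧ N.IsCircuit (insert q Z₁)) :
    ∃! N : Matroid α, M.IsExtensionBy N {p, q} ∧
      N.IsCircuit (insert p X₀) ∧ N.IsCircuit (insert p Y₀) ∧
      N.IsCircuit (insert q Y₁) ∧ N.IsCircuit (insert q Z₁) := by
  have g₀ := hsep₁.isGutsPair hX₀ hY₀ h₀
  have g₁ := hsep₂.isGutsPair hY₁ hZ₁ h₁
  have hXYE : X ∪ Y ⊆ M.E := hE ▸ subset_union_left
  have hXE : X ⊆ M.E := subset_union_left.trans hXYE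
  have hZE : Z ⊆ M.E := hE ▸ subset_union_right
  have hYZE : Y ∪ Z ⊆ M.E := hsep₁.union_eq ▸ subset_union_right
  obtain ⟨P, hP, hPX, hPY⟩ := hp
  obtain ⟨Q, hQ, hQY, hQZ⟩ := hq
  have hpM := hP.notMem_ground
  have hqM := hQ.notMem_ground
  have hpX₀ : p ∉ X₀ := fun h ↦ hpM (hXE (g₀.left_subset h))
  have hpY₀ : p ∉ Y₀ := fun h ↦ hpM (hYZE (g₀.right_subset h))
  have hqY₁ : q ∉ Y₁ := fun h ↦ hqM (hXYE (g₁.left_subset h))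
  have hqZ₁ : q ∉ Z₁ := fun h ↦ hqM (hZE (g₁.right_subset h))
  have := hP.finite
  have hqP : q ∉ P.E := by
    rw [hP.ground_eq]
    simp [hqM, hpq.symm]
  have hpP := hPX.isNonloop_of_insert hpX₀ g₀.left_nonempty
  have hpX := P.closure_subset_closure g₀.left_subset (hPX.mem_closure_of_insert hpX₀)
  have hpYZ := P.closure_subset_closure g₀.right_subset (hPY.mem_closure_of_insert hpY₀)
  have hpXY : p ∈ P.closure (X ∪ Y) := P.closure_subset_closure subset_union_left hpX
  have gP₀ := hP.isGutsPair g₀ hXE hYZE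
  have gP : P.IsGutsPair (insert p (X ∪ Y)) Z Y₁ Z₁ :=
    (hP.isGutsPair g₁ hXYE hZE).insert hpXY fun h ↦ hpM (hZE h)
  have hPE : insert p (X ∪ Y) ∪ Z = P.E := by
    rw [hP.ground_eq, insert_union, hE, union_singleton]
  have hcomp : P.GutsCompatible (insert p (X ∪ Y)) Z Y₁ Z₁ := by
    have hM : M.GutsCompatible (X ∪ Y) Z Y₁ Z₁ := hQ.gutsCompatible g₁ hXYE hZE
      (hQY.isNonloop_of_insert hqY₁ g₁.left_nonempty) (hQY.mem_closure_of_insert hqY₁)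
      (hQZ.mem_closure_of_insert hqZ₁)
    refine (show P.GutsCompatible (X ∪ Y) Z Y₁ Z₁ from fun F hF G hG ↦ ?_).insert hpXY
      g₁.right_subset fun F hF ↦ ?_
    · have hF' := hF.trans hXYE
      have hG' := hG.trans hZE
      rw [← hP.localConnectivity_eq hF' hZE, ← hP.localConnectivity_eq hXYE hG',
        ← hP.localConnectivity_eq hF' (g₁.right_subset.trans hZE),
        ← hP.localConnectivity_eq (g₁.left_subset.trans hXYE) hG',
        ← hP.localConnectivity_eq hF' hG']
      exact hM F hF G hG
    -- The trade uses the first separation, with `C := Y`: replacements stay inside `X ∪ Y` and are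
    -- invisible from subsets of `Z ⊆ Y ∪ Z`.
    · obtain ⟨F', hF', h⟩ := exists_forall_localConnectivity_insert_eq gP₀.conn_eq
        gP₀.left_subset gP₀.left_conn_eq hpP (hPX.mem_closure_of_insert hpX₀) hpYZ
        subset_union_left hF
      exact ⟨F', hF', fun T hT ↦ h T (hT.trans subset_union_right)⟩
  obtain ⟨N, hPN, hN⟩ := gP.exists_isExtensionBy hPE hcomp hqP
  have := hPN.finite
  have hMN := hP.trans hPN
  have hqN : N.IsNonloop q := by
    -- The empty set fails every clause: its modular defect is 2 and its connectivities vanish.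
    rw [← not_isLoop_iff hPN.mem_ground, isLoop_iff, loops, hN ∅ (empty_subset _)]
    have := gP.conn_eq
    simp only [localConnectivity] at this
    simp [SpansGuts, localConnectivity]
    omega
  have hsub : insert p (X ∪ Y) ⊆ P.E := hPE ▸ subset_union_left
  have hZP : Z ⊆ P.E := hPE ▸ subset_union_right
  have hqY₁N : q ∈ N.closure Y₁ := by
    rw [hN _ (gP.left_subset.trans hsub), inter_eq_left.2 gP.left_subset]
    exact .inr (.inl gP.pair_conn_eq.ge)
  have hqZ₁N : q ∈ N.closure Z₁ := by
    rw [hN _ (gP.right_subset.trans hZP), inter_eq_left.2 gP.right_subset]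
    exact .inr (.inr gP.pair_conn_eq.ge)
  refine ⟨N, ⟨hMN, ?_, ?_, ?_, ?_⟩, ?_⟩
  · exact IsCircuit.of_delete (D := {q}) (hPN.2.symm ▸ hPX)
  · exact IsCircuit.of_delete (D := {q}) (hPN.2.symm ▸ hPY)
  · exact hY₁.isCircuit_insert hMN hXYE hZE hqN hqM hqY₁N
      (N.closure_subset_closure g₁.right_subset hqZ₁N)
  · exact hZ₁.isCircuit_insert hMN hZE hXYE hqN hqM hqZ₁N
      (N.closure_subset_closure g₁.left_subset hqY₁N)
  · rintro N' ⟨hN', hpX', hpY', hqY', hqZ'⟩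
    obtain ⟨hD, hDN'⟩ := hN'.of_delete_right hpq
    have hqX₀ : q ∉ insert p X₀ := by
      simp only [mem_insert_iff, hpq.symm, false_or]
      exact fun h ↦ hqM (hXE (g₀.left_subset h))
    have hqY₀ : q ∉ insert p Y₀ := by
      simp only [mem_insert_iff, hpq.symm, false_or]
      exact fun h ↦ hqM (hYZE (g₀.right_subset h))
    have hDX := (circuit_iff_delete_of_disjoint (disjoint_singleton_right.2 hqX₀)).1 hpX'
    have hDY := (circuit_iff_delete_of_disjoint (disjoint_singleton_right.2 hqY₀)).1 hpY'
    -- Uniqueness for `p` identifies `N' ＼ {q}` with `P`, so `N` and `N'` become extensions of the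
    -- same matroid by `q`.
    have hDP : N' ＼ {q} = P := g₀.extension_unique hsep₁.union_eq hD hP
      (hDX.isNonloop_of_insert hpX₀ g₀.left_nonempty) (hDX.mem_closure_of_insert hpX₀)
      (hDY.mem_closure_of_insert hpY₀) hpP (hPX.mem_closure_of_insert hpX₀)
      (hPY.mem_closure_of_insert hpY₀)
    rw [hDP] at hDN'
    exact gP.extension_unique hPE hDN' hPN
      (hqY'.isNonloop_of_insert hqY₁ g₁.left_nonempty) (hqY'.mem_closure_of_insert hqY₁)
      (hqZ'.mem_closure_of_insert hqZ₁) hqN hqY₁N hqZ₁N
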